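/- Topos means elementary topos: a category with finite limits, exponentials and a subobject classifier $\Omega$; it is degenerate if its initial object is terminal. A subtopos $j:\mathcal{E}_j\to\mathcal{E}$ is a geometric morphism with fully faithful direct image $j_*$. A geometric morphism $f$ is essential if $f^*$ has a left adjoint $f_!$; it is hyperconnected if $f^*$ is fully faithful and its image is closed under subobjects; it is local if $f_*$ has a fully faithful right adjoint $f^!$. In the local case let $\phi:f^*\to f^!$ be the composite $f^*\to f^*f_*f^!\to f^!$ of $f^*\varepsilon^{-1}$ and $\beta_{f^!}$, where $\varepsilon$ and $\beta$ are the counits of $f_*\dashv f^!$ and $f^*\dashv f_*$; call $f$ a quality type if it is local and $\phi$ is an isomorphism. For a local $p:\mathcal{E}\to\mathcal{S}$, level $0$ is the subtopos $p_*\dashv p^!:\mathcal{S}\to\mathcal{E}$, which is essential with leftmost adjoint $p^*$. A subtopos $j$ of $\mathcal{E}$ is above a subtopos $k$ if $k_*$ factors up to isomorphism through $j_*$; if $k$ is essential, $j$ is way-above $k$ if, moreover, $k_!$ factors up to isomorphism through $j_*$. A subquality of $p$ is a subtopos $j$ of $\mathcal{E}$ above level $0$ such that the composite $pj$ is a quality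 type; it is an essential subquality if $j$ is also essential. Level $\epsilon$ of $p$, when it exists, is the largest (with respect to "above") essential subquality of $p$. **Statement.** Let $p:\mathcal{E}\to\mathcal{S}$ be a local, essential and hyperconnected geometric morphism between toposes, and assume that $p_!\Omega=1$ (that is, $p_!\Omega$ is terminal in $\mathcal{S}$), where $\Omega$ is the subobject classifier of $\mathcal{E}$. 1. If some essential subquality $l:\mathcal{E}_l\to\mathcal{E}$ of $p$ is way-above level $0$, then $\mathcal{S}$ is degenerate. 2. If level $\epsilon$ of $p$ exists and is way-above level $0$, then $\mathcal{E}$ is degenerate. -/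

import Mathlib

open CategoryTheory CategoryTheory.Limits

universe v₁ v₂ v₃ u₁ u₂ u₃

/-- An elementary topos: a category with finite limits and a subobject classifier in which
every functor `X × -` has a right adjoint. -/
class ElementaryTopos (C : Type u₁) [Category.{v₁} C] : Prop
    extends HasFiniteLimits C, HasSubobjectClassifier C where
  exponentiable : ∀ X : C, (prod.functor.obj X).IsLeftAdjoint

/-- A topos is degenerate if its initial object is terminal. -/
def IsDegenerate (C : Type u₁) [Category.{v₁} C] : Prop :=
  ∃ Z : C, Nonempty (IsInitial Z) ∧ Nonempty (IsTerminal Z)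

/-- A geometric morphism `f : E ⟶ S`: a direct image `f_* : E ⥤ S` with a left exact
left adjoint `f^* : S ⥤ E`. -/
structure GeometricMorphism (E : Type u₁) [Category.{v₁} E] (S : Type u₂) [Category.{v₂} S] where
  direct : E ⥤ S
  inverse : S ⥤ E
  adj : inverse ⊣ direct
  leftExact : PreservesFiniteLimits inverse

noncomputable section

namespace GeometricMorphism

variable {E : Type u₁} [Category.{v₁} E] {S : Type u₂} [Category.{v₂} S]
  {L : Type u₃} [Category.{v₃} L]

/-- The composite of `j : L ⟶ E` and `p : E ⟶ S`. -/
def comp (j : GeometricMorphism L E) (p : GeometricMorphism E S) : GeometricMorphism L S where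
  direct := j.direct ⋙ p.direct
  inverse := p.inverse ⋙ j.inverse
  adj := p.adj.comp j.adj
  leftExact :=
    haveI := p.leftExact
    haveI := j.leftExact
    comp_preservesFiniteLimits p.inverse j.inverse

/-- `j : L ⟶ E` is a geometric inclusion, i.e. (it exhibits `L` as) a subtopos of `E`. -/
class IsSubtopos (j : GeometricMorphism L E) : Prop where
  full : j.direct.Full
  faithful : j.direct.Faithful

/-- `f` is essential if `f^*` has a left adjoint. -/
class IsEssential (f : GeometricMorphism E S) : Prop where
  isRightAdjoint : f.inverse.IsRightAdjoint

attribute [instance] IsEssential.isRightAdjoint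

/-- The left adjoint `f_! : E ⥤ S` of `f^*`, for an essential `f`. -/
def shriek (f : GeometricMorphism E S) [f.IsEssential] : E ⥤ S :=
  f.inverse.leftAdjoint

/-- `p` is hyperconnected: `p^*` is fully faithful and its (replete) image is closed under
subobjects. -/
class IsHyperconnected (p : GeometricMorphism E S) : Prop where
  full : p.inverse.Full
  faithful : p.inverse.Faithful
  closed_under_subobjects :
    ∀ ⦃X : E⦄ ⦃A : S⦄ (m : X ⟶ p.inverse.obj A), Mono m → p.inverse.essImage X

/-- `p` is local if `p_*` has a fully faithful right adjoint. -/
class IsLocal (p : GeometricMorphism E S) : Prop where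
  isLeftAdjoint : p.direct.IsLeftAdjoint
  full : p.direct.rightAdjoint.Full
  faithful : p.direct.rightAdjoint.Faithful

attribute [instance] IsLocal.isLeftAdjoint

section Local

variable (p : GeometricMorphism E S) [p.IsLocal]

/-- The right adjoint `p^! : S ⥤ E` of `p_*`, for a local `p`. -/
def upperShriek : S ⥤ E := p.direct.rightAdjoint

/-- The adjunction `p_* ⊣ p^!`. -/
def adjLocal : p.direct ⊣ p.upperShriek :=
  Adjunction.ofIsLeftAdjoint p.direct

instance : p.upperShriek.Full := IsLocal.full

instance : p.upperShriek.Faithful := IsLocal.faithful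

/-- The canonical transformation `φ : p^* ⟶ p^!` of a local `p`: the composite of
`p^* ε⁻¹ : p^* ⟶ p^* p_* p^!` and `β p^! : p^* p_* p^! ⟶ p^!`, where `ε` and `β` are the counits
of `p_* ⊣ p^!` and `p^* ⊣ p_*`. -/
def phi : p.inverse ⟶ p.upperShriek where
  app A := p.inverse.map (inv (p.adjLocal.counit.app A)) ≫ p.adj.counit.app (p.upperShriek.obj A)
  naturality A B f := by
    have h : f ≫ inv (p.adjLocal.counit.app B) =
        inv (p.adjLocal.counit.app A) ≫ p.direct.map (p.upperShriek.map f) := by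
      rw [IsIso.comp_inv_eq, Category.assoc, IsIso.eq_inv_comp]
      exact (p.adjLocal.counit.naturality f).symm
    have h' := p.adj.counit.naturality (p.upperShriek.map f)
    dsimp at h'
    rw [← Category.assoc, ← Functor.map_comp, h, Functor.map_comp, Category.assoc, h',
      Category.assoc]

/-- The centre ("level 0") of a local `p`: the subtopos `S ⟶ E` with direct image `p^!` and
inverse image `p_*`. -/
def centre : GeometricMorphism S E where
  direct := p.upperShriek
  inverse := p.direct
  adj := p.adjLocal
  leftExact :=
    haveI : p.direct.IsRightAdjoint := p.adj.isRightAdjoint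
    inferInstance

instance : p.centre.IsSubtopos where
  full := inferInstanceAs p.upperShriek.Full
  faithful := inferInstanceAs p.upperShriek.Faithful

instance : p.centre.IsEssential where
  isRightAdjoint := p.adj.isRightAdjoint

end Local

/-- A local geometric morphism is a quality type if the canonical `φ : q^* ⟶ q^!` is an
isomorphism. -/
class IsQualityType (q : GeometricMorphism E S) : Prop extends q.IsLocal where
  isIso_phi : IsIso q.phi

/-- The subtopos `k` of `E` is above the subtopos `j` of `E`: the direct image of `j` factors
(up to isomorphism) through that of `k`. -/
def IsAbove {K : Type u₂} [Category.{v₂} K] (k : GeometricMorphism K E)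
    (j : GeometricMorphism L E) : Prop :=
  ∃ H : L ⥤ K, Nonempty (H ⋙ k.direct ≅ j.direct)

/-- The subtopos `j` of `E` is way-above the level (essential subtopos) `l` of `E`: it is above
`l` and moreover `l_!` factors (up to isomorphism) through `j_*`. -/
def IsWayAbove {K : Type u₂} [Category.{v₂} K] (j : GeometricMorphism K E)
    (l : GeometricMorphism L E) [l.IsEssential] : Prop :=
  j.IsAbove l ∧ ∃ H : L ⥤ K, Nonempty (H ⋙ j.direct ≅ l.shriek)

/-- A subquality of a local `p`: a subtopos `j` above level 0 such that `p j` is a quality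
type. -/
structure IsSubquality (p : GeometricMorphism E S) [p.IsLocal] (j : GeometricMorphism L E) :
    Prop where
  isSubtopos : j.IsSubtopos
  above_centre : j.IsAbove p.centre
  isQualityType : (j.comp p).IsQualityType

/-- An essential subquality of a local `p`. -/
structure IsEssentialSubquality (p : GeometricMorphism E S) [p.IsLocal]
    (j : GeometricMorphism L E) : Prop extends IsSubquality p j where
  isEssential : j.IsEssential

/-- `e` is level `ε` of the local `p`: the largest essential subquality of `p`.

A subtopos of `E` is equivalent to a full subcategory of `E`, so it is enough to compare `e` with
the subtoposes that live in the same universes as `E`. -/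
structure IsLevelEpsilon (p : GeometricMorphism E S) [p.IsLocal] (e : GeometricMorphism L E) :
    Prop extends IsEssentialSubquality p e where
  largest : ∀ (K : Type u₁) [Category.{v₁} K] [ElementaryTopos K] (k : GeometricMorphism K E),
    IsEssentialSubquality p k → e.IsAbove k

end GeometricMorphism

end

/-! Suppose a subquality $l$ is way-above level $0$. Then $p^*$ takes values in $l$-sheaves, so $p^*
\cong l_* l^* p^*$. Since $pl$ is a quality type, $l^* p^* \cong (pl)^!$, and $l_* (pl)^! \cong p^!$
because $l$ is above level $0$. Hence $p^* \cong p^!$, and uniqueness of left adjoints gives $p_!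
\cong p_*$. Now $p_!\Omega = 1$ reads $p_*\Omega = 1$: $\Omega$ has exactly one global point, which
collapses $\mathcal{E}$, and with it $\mathcal{S}$, since $p^*$ is fully faithful. -/

noncomputable section

namespace ElementaryTopos

variable {C : Type u₁} [Category.{v₁} C] [ElementaryTopos C]

/-- If `T` has a single map to `Ω` then it has no proper subobjects. -/
theorem isIso_of_mono_of_subsingleton {T U : C}
    (h : ∀ f g : T ⟶ HasSubobjectClassifier.Ω C, f = g) (m : U ⟶ T) [Mono m] : IsIso m := by
  have hm := HasSubobjectClassifier.isPullback_χ m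
  have h1 := HasSubobjectClassifier.isPullback_χ (𝟙 T)
  -- Now `𝟙 T` and `m` are pullbacks of truth along the same map, so `𝟙 T` factors through `m`; a
  -- split mono with this section is invertible.
  rw [h (HasSubobjectClassifier.χ (𝟙 T)) (HasSubobjectClassifier.χ m)] at h1
  have hs : hm.lift (𝟙 T) _ h1.w ≫ m = 𝟙 T := hm.lift_fst _ _ _
  exact ⟨_, by rw [← cancel_mono m, Category.assoc, hs, Category.comp_id, Category.id_comp], hs⟩

/-- If `T` has a single map to `Ω` then it has at most one map to any object. -/
theorem map_ext_of_subsingleton {T X : C}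
    (h : ∀ f g : T ⟶ HasSubobjectClassifier.Ω C, f = g) (x y : T ⟶ X) : x = y := by
  have := isIso_of_mono_of_subsingleton h (equalizer.ι x y)
  rw [← cancel_epi (equalizer.ι x y), equalizer.condition]

/-- By exponentiability, maps `X ⨯ T ⟶ Y` are points of the exponential `Y ^ X`, and `X ⨯ T`
retracts onto `X`. -/
theorem hom_ext_of_point_ext {T : C} (hT : IsTerminal T)
    (h : ∀ (X : C) (x y : T ⟶ X), x = y) {X Y : C} (f g : X ⟶ Y) : f = g := by
  have := ElementaryTopos.exponentiable X
  have adj := Adjunction.ofIsLeftAdjoint (prod.functor.obj X)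
  have e : (prod.fst : X ⨯ T ⟶ X) ≫ f = prod.fst ≫ g :=
    (adj.homEquiv T Y).injective (h _ _ _)
  have s : prod.lift (𝟙 X) (hT.from X) ≫ (prod.fst : X ⨯ T ⟶ X) = 𝟙 X := prod.lift_fst _ _
  rw [← Category.id_comp f, ← Category.id_comp g, ← s, Category.assoc, e, Category.assoc]

/-- If the subobject classifier of a topos has a single point then every object is terminal. -/
theorem nonempty_isTerminal {T : C} (hT : IsTerminal T)
    (h : ∀ f g : T ⟶ HasSubobjectClassifier.Ω C, f = g) (X : C) : Nonempty (IsTerminal X) := by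
  have ext {Y Z : C} (f g : Y ⟶ Z) : f = g :=
    hom_ext_of_point_ext hT (fun _ => map_ext_of_subsingleton h) f g
  have : Mono (hT.from X) := ⟨fun _ _ _ => ext _ _⟩
  have := isIso_of_mono_of_subsingleton h (hT.from X)
  exact ⟨hT.ofIso (asIso (hT.from X)).symm⟩

end ElementaryTopos

namespace GeometricMorphism

variable {E : Type u₁} [Category.{v₁} E] {S : Type u₂} [Category.{v₂} S]
  {L : Type u₃} [Category.{v₃} L]

/-- The adjunction `p_! ⊣ p^*` of an essential `p`. -/
def adjShriek (p : GeometricMorphism E S) [p.IsEssential] : p.shriek ⊣ p.inverse :=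
  Adjunction.ofIsRightAdjoint p.inverse

/-- The leftmost adjoint of the centre of `p` is `p^*`. -/
def centreShriekIso (p : GeometricMorphism E S) [p.IsLocal] : p.centre.shriek ≅ p.inverse :=
  p.centre.adjShriek.leftAdjointUniq p.adj

/-- If the subtopos `l` is above the centre of `p` via `H` then `H` is right adjoint to the
direct image of `p l`. -/
def adjOfAboveCentre (p : GeometricMorphism E S) [p.IsLocal] (l : GeometricMorphism L E)
    [l.IsSubtopos] (H : S ⥤ L) (e : H ⋙ l.direct ≅ p.upperShriek) :
    (l.comp p).direct ⊣ H :=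
  haveI : l.direct.Full := IsSubtopos.full
  haveI : l.direct.Faithful := IsSubtopos.faithful
  -- $\mathcal{S}(p_* l_* X, A) \cong \mathcal{E}(l_* X, p^! A) \cong \mathcal{E}(l_* X, l_* H A)
  -- \cong \mathcal{L}(X, H A)$.
  p.adjLocal.restrictFullyFaithful (Functor.FullyFaithful.ofFullyFaithful l.direct)
    (Functor.FullyFaithful.id S) (Functor.rightUnitor _).symm
    (Functor.leftUnitor _ ≪≫ e.symm)

/-- An object in the image of a subtopos is a sheaf for it. -/
def factorsIso (l : GeometricMorphism L E) [l.IsSubtopos] (K : S ⥤ L) :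
    (K ⋙ l.direct) ⋙ l.inverse ⋙ l.direct ≅ K ⋙ l.direct :=
  haveI : l.direct.Full := IsSubtopos.full
  haveI : l.direct.Faithful := IsSubtopos.faithful
  Functor.isoWhiskerLeft K (Functor.isoWhiskerRight (asIso l.adj.counit) l.direct)

/-- If some subquality of `p` is way-above the centre of `p` then `p^*` and `p^!` are isomorphic. -/
theorem IsSubquality.nonempty_inverse_iso_upperShriek {p : GeometricMorphism E S} [p.IsLocal]
    {l : GeometricMorphism L E} (hl : p.IsSubquality l) (hw : l.IsWayAbove p.centre) :
    Nonempty (p.inverse ≅ p.upperShriek) := by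
  obtain ⟨⟨H, ⟨e⟩⟩, K, ⟨k⟩⟩ := hw
  have := hl.isSubtopos
  have := hl.isQualityType
  let φ : (l.comp p).inverse ≅ (l.comp p).upperShriek :=
    haveI := IsQualityType.isIso_phi (q := l.comp p)
    asIso (l.comp p).phi
  let k' : K ⋙ l.direct ≅ p.inverse := k ≪≫ p.centreShriekIso
  -- Way-aboveness enters here: `p.inverse` factors through `l.direct`, so its values are sheaves.
  let a : p.inverse ≅ (p.inverse ⋙ l.inverse) ⋙ l.direct :=
    k'.symm ≪≫ (l.factorsIso K).symm ≪≫ Functor.isoWhiskerRight k' (l.inverse ⋙ l.direct)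
  -- Both `(l.comp p).upperShriek` and `H` are right adjoint to `(l.comp p).direct`.
  let b : p.inverse ⋙ l.inverse ≅ H :=
    φ ≪≫ (l.comp p).adjLocal.rightAdjointUniq (p.adjOfAboveCentre l H e)
  exact ⟨a ≪≫ Functor.isoWhiskerRight b l.direct ≪≫ e⟩

/-- An isomorphism `p^* ≅ p^!` induces an isomorphism `p_! ≅ p_*`. -/
def shriekIsoDirect (p : GeometricMorphism E S) [p.IsLocal] [p.IsEssential]
    (i : p.inverse ≅ p.upperShriek) : p.shriek ≅ p.direct :=
  (p.adjShriek.ofNatIsoRight i).leftAdjointUniq p.adjLocal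

/-- Points of $\Omega$ are maps $p^*1 \to \Omega$, that is, maps $1 \to p_*\Omega \cong p_!\Omega =
1$, so there is only one. -/
theorem IsSubquality.nonempty_isTerminal [ElementaryTopos E] [ElementaryTopos S]
    {p : GeometricMorphism E S} [p.IsLocal] [p.IsEssential]
    (hΩ : IsTerminal (p.shriek.obj (HasSubobjectClassifier.Ω E)))
    {l : GeometricMorphism L E} (hl : p.IsSubquality l) (hw : l.IsWayAbove p.centre) (X : E) :
    Nonempty (IsTerminal X) := by
  obtain ⟨i⟩ := hl.nonempty_inverse_iso_upperShriek hw
  have := p.leftExact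
  have hp : IsTerminal (p.direct.obj (HasSubobjectClassifier.Ω E)) :=
    hΩ.ofIso ((p.shriekIsoDirect i).app _)
  refine ElementaryTopos.nonempty_isTerminal
    (IsTerminal.isTerminalObj p.inverse (⊤_ S) terminalIsTerminal) (fun f g => ?_) X
  exact (p.adj.homEquiv _ _).injective (hp.hom_ext _ _)

end GeometricMorphism

/-- A category all of whose objects are terminal is degenerate, as soon as it is inhabited. -/
theorem isDegenerate_of_forall_isTerminal {C : Type u₁} [Category.{v₁} C] (Z : C)
    (h : ∀ X : C, Nonempty (IsTerminal X)) : IsDegenerate C :=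
  ⟨Z, ⟨IsInitial.ofUniqueHom (fun X => (h X).some.from Z) (fun X _ => (h X).some.hom_ext _ _)⟩,
    h Z⟩

end

theorem mainTheorem8
    {E : Type u₁} [Category.{v₁} E] [ElementaryTopos E]
    {S : Type u₂} [Category.{v₂} S] [ElementaryTopos S]
    (p : GeometricMorphism E S) [p.IsLocal] [p.IsEssential] [p.IsHyperconnected]
    (hΩ : Nonempty (IsTerminal (p.shriek.obj (HasSubobjectClassifier.Ω E)))) :
    (∀ (L : Type u₃) [Category.{v₃} L] [ElementaryTopos L] (l : GeometricMorphism L E),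
      p.IsEssentialSubquality l → l.IsWayAbove p.centre → IsDegenerate S) ∧
    (∀ (L : Type u₃) [Category.{v₃} L] [ElementaryTopos L] (e : GeometricMorphism L E),
      p.IsLevelEpsilon e → e.IsWayAbove p.centre → IsDegenerate E) := by
  obtain ⟨hΩ⟩ := hΩ
  refine ⟨fun L _ _ l hl hw => ?_, fun L _ _ e he hw => ?_⟩
  · have : p.inverse.Full := GeometricMorphism.IsHyperconnected.full
    have : p.inverse.Faithful := GeometricMorphism.IsHyperconnected.faithful
    -- Terminality of `p.inverse.obj A` descends to `A`, because a fully faithful functor reflects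
    -- terminal objects.
    exact isDegenerate_of_forall_isTerminal (⊤_ S) fun A =>
      (hl.toIsSubquality.nonempty_isTerminal hΩ hw (p.inverse.obj A)).map fun h =>
        h.isTerminalOfObj p.inverse A
  · exact isDegenerate_of_forall_isTerminal (p.inverse.obj (⊤_ S)) fun X =>
      he.toIsEssentialSubquality.toIsSubquality.nonempty_isTerminal hΩ hw X
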